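/- Notation. For $p\in(0,\infty]$ and $v\in\mathbb{R}^d$ let $\lVert v\rVert_p=\bigl(\sum_{i}|v_i|^p\bigr)^{1/p}$ if $p<\infty$, and $\lVert v\rVert_\infty=\max_i|v_i|$. Write $[t]_-=\min\{0,t\}$ and $1/\infty=0$. A ReLU network $f:\mathbb{R}^d\to\mathbb{R}$ of depth $L$ is a function $f=T^{(L)}\circ[\cdot]_+\circ T^{(L-1)}\circ\dots\circ[\cdot]_+\circ T^{(1)}$ with affine maps $T^{(l)}:\mathbb{R}^{d_{l-1}}\to\mathbb{R}^{d_l}$, $d_0=d$, $d_L=1$, where $[t]_+=\max\{0,t\}$ is applied coordinatewise; its width is $\max\{d_1,\dots,d_{L-1}\}$. A dataset of $N$ points with $C$ classes is a family $(x_i,y_i)_{i=1}^N$ with $x_i\in\mathbb{R}^d$ and $y_i\in\{1,\dots,C\}$. It is $\delta$-separated if $\min\{\lVert x_i-x_j\rVert_2 : y_i\neq y_j\}=\delta$ (in particular at least two labels occur). A function $f$ $(\sigma,p)$-robustly memorizes it if $f(x)=y_i$ for every $i$ and every $x\in\mathbb{R}^d$ with $\lVert x-x_i\rVert_p\le\sigma$.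 Theorem. There is a universal constant $c>0$ with the following property. Let $N,d,C\ge 2$ and $k$ be integers with $7\le k\le d+5$, let $p\in(0,\infty]$, $\delta>0$ and $\sigma\ge 0$, and suppose that $$\frac{\sigma}{\delta}\le a_{p,d}\,N^{-\frac{2}{k-6}},\qquad a_{p,d}:=\frac{1}{8\sqrt e}\,d^{-\frac12+\left[\frac1p-\frac12\right]_-}.$$ Then for every $\delta$-separated dataset of $N$ points in $\mathbb{R}^d$ with $C$ classes there is a ReLU network $f:\mathbb{R}^d\to\mathbb{R}$ of width $k$ and depth at most $c\,N\,k\log_2 k$ that $(\sigma,p)$-robustly memorizes the dataset. -/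

import Mathlib

/-- A feedforward ReLU neural network with input dimension `n` and scalar output.
`output W b` is the last affine layer `x ↦ W x + b` into `ℝ`;
`hidden m W b g` first applies the affine map `x ↦ W x + b` into `ℝᵐ`, then the ReLU
coordinatewise, and then the remaining network `g`. Weights and biases are arbitrary reals. -/
inductive ReLUNetwork : ℕ → Type
  | output {n : ℕ} (W : Matrix (Fin 1) (Fin n) ℝ) (b : Fin 1 → ℝ) : ReLUNetwork n
  | hidden {n : ℕ} (m : ℕ) (W : Matrix (Fin m) (Fin n) ℝ) (b : Fin m → ℝ)
      (g : ReLUNetwork m) : ReLUNetwork n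

namespace ReLUNetwork

/-- The function `ℝⁿ → ℝ` computed by a network. -/
noncomputable def eval : {n : ℕ} → ReLUNetwork n → (Fin n → ℝ) → ℝ
  | _, output W b, x => (W.mulVec x + b) 0
  | _, hidden _ W b g, x => g.eval (fun i => max 0 ((W.mulVec x + b) i))

/-- The depth: the number of affine layers, the output layer included. -/
def depth : {n : ℕ} → ReLUNetwork n → ℕ
  | _, output _ _ => 1
  | _, hidden _ _ _ g => g.depth + 1

/-- The width: the largest dimension of a hidden layer (`0` if there is no hidden layer). -/
def width : {n : ℕ} → ReLUNetwork n → ℕ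
  | _, output _ _ => 0
  | _, hidden m _ _ g => max m g.width

end ReLUNetwork

/-- The `ℓ_p` (quasi-)norm on `ℝᵈ`, for `p ∈ (0, ∞]`: `(∑ |vᵢ| ^ p) ^ (1 / p)` if `p < ∞`, and
`max |vᵢ|` if `p = ∞`. -/
noncomputable def lpNorm {d : ℕ} (p : ENNReal) (v : Fin d → ℝ) : ℝ :=
  ‖(WithLp.toLp p v : PiLp p (fun _ : Fin d => ℝ))‖

theorem lpNorm_of_ne_top {d : ℕ} (p : ENNReal) (hp : 0 < p) (hp' : p ≠ ⊤) (v : Fin d → ℝ) :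
    lpNorm p v = (∑ i, |v i| ^ p.toReal) ^ (1 / p.toReal) := by
  simp [lpNorm, PiLp.norm_eq_sum (ENNReal.toReal_pos hp.ne' hp')]

theorem lpNorm_top {d : ℕ} (v : Fin d → ℝ) : lpNorm ⊤ v = ⨆ i, |v i| := by
  simp [lpNorm, PiLp.norm_eq_ciSup]

/-- A labeled dataset of `N` points in `ℝᵈ` with labels in `{1, …, C}`. -/
structure LabeledDataset (d N C : ℕ) where
  point : Fin N → Fin d → ℝ
  label : Fin N → ℕ
  one_le_label : ∀ i, 1 ≤ label i
  label_le : ∀ i, label i ≤ C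

/-- The minimal Euclidean distance between two differently labeled points exists (so that at
least two labels occur) and equals `δ`. -/
def LabeledDataset.IsSeparated {d N C : ℕ} (D : LabeledDataset d N C) (δ : ℝ) : Prop :=
  IsLeast {r : ℝ | ∃ i j, D.label i ≠ D.label j ∧ r = lpNorm 2 (D.point i - D.point j)} δ

/-- `f` is equal to the label `yᵢ` on the whole closed `ℓ_p` ball of radius `σ` around each data
point `xᵢ`. -/
def RobustlyMemorizes {d N C : ℕ} (σ : ℝ) (p : ENNReal) (f : (Fin d → ℝ) → ℝ)
    (D : LabeledDataset d N C) : Prop :=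
  ∀ (i : Fin N) (x : Fin d → ℝ), lpNorm p (x - D.point i) ≤ σ → f x = (D.label i : ℝ)

/-- The constant `a_{p,d} = (1 / (8 √e)) d ^ (-1/2 + min {0, 1/p - 1/2})`, with `1/∞ = 0`. -/
noncomputable def radiusConstant (p : ENNReal) (d : ℕ) : ℝ :=
  1 / (8 * Real.sqrt (Real.exp 1)) * (d : ℝ) ^ (-(1 / 2 : ℝ) + min 0 ((p⁻¹).toReal - 1 / 2))

/-!
The dataset is mapped to `ℝᵐ`, with `m = k - 6`, by a linear map that does not collapse differently
labeled points, and is memorized there by a deep network of width `m + 6`.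

*Projection.* Put `q = N ^ (-2 / m)`. For a standard Gaussian vector `a` in `ℝᵈ`, the density bound
gives `|⟪v, a⟫| ≤ (q / 2) ‖v‖` with probability at most `3 q / 4`, while `‖a‖ ^ 2` has mean `d`. The
first moment method, applied to the number of pairs that `a` fails to separate plus a multiple of
`‖a‖ ^ 2`, yields a vector of norm at most `2 √d` that separates all but a fraction `q` of a given
set of pairs (`exists_direction`). After `m` such choices fewer than `q ^ m N ^ 2 = 1` of the
differently labeled pairs are left (`exists_directions`). Hence there are `w₁, …, w_m` of norm at
most `2 √d` such that differently labeled points are at sup distance more than `q δ / 2` after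
applying `x ↦ (w_l ⬝ᵥ x)_l`. An `ℓ_p` ball of radius `σ` lies in a Euclidean ball of radius
`d ^ (-min {0, 1/p - 1/2}) σ` (`lpNorm_two_le`), so its image lies in a sup norm ball of some
radius `r`, and the hypothesis on `σ / δ` makes `2 r` smaller than `q δ / 2`.

*Network.* With `R = q δ / 2 - r > r`, the function
`maxᵢ yᵢ (1 - (max r ‖w (x - xᵢ)‖ - r) / (R - r))`, truncated below at `0`, robustly memorizes the
data: on the ball around `xⱼ` the term `j` equals `yⱼ`, terms with the same label are at most
`yⱼ`, and terms with a different label are nonpositive. It is computed by keeping the `m` numbers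
`w_l ⬝ᵥ x` (shifted to be nonnegative on the region of interest, where the ReLU leaves them alone)
and two running maxima, an inner one for the sup norm and an outer one for the value. A running
maximum is stored as a sum of two neurons, since `max a h = a + max 0 (h - a)` is then available
after a single layer (`HasAccumulators.succ`). Each data point costs `2 m + 1` layers.
-/

/-! ### Random directions -/

open MeasureTheory ProbabilityTheory in
/-- Small ball estimate, from the bound `1 / √(2 π s)` on the Gaussian density. The constant
`√(2 / π)` that this gives is rounded up to `3 / 2`. -/
theorem gaussianReal_zero_abs_le {s : NNReal} (hs : s ≠ 0) {t : ℝ} (ht : 0 ≤ t) :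
    (gaussianReal 0 s).real {x | |x| ≤ t * Real.sqrt s} ≤ 3 / 2 * t := by
  have hs0 : (0 : ℝ) < s := by exact_mod_cast pos_iff_ne_zero.2 hs
  have hset : {x : ℝ | |x| ≤ t * Real.sqrt s} =
      Set.Icc (-(t * Real.sqrt s)) (t * Real.sqrt s) := by
    ext x; simp [abs_le]
  have hpi : (4 / 3 : ℝ) ≤ Real.sqrt (2 * Real.pi) :=
    Real.le_sqrt_of_sq_le (by nlinarith [Real.pi_gt_three])
  have hbound : ∀ x, gaussianPDFReal 0 s x ≤ (Real.sqrt (2 * Real.pi * s))⁻¹ := by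
    intro x
    rw [gaussianPDFReal]
    refine mul_le_of_le_one_right (by positivity) (Real.exp_le_one_iff.2 ?_)
    exact div_nonpos_of_nonpos_of_nonneg (neg_nonpos.2 (sq_nonneg _)) (by positivity)
  rw [Measure.real, gaussianReal_apply_eq_integral 0 hs,
    ENNReal.toReal_ofReal (integral_nonneg fun x => gaussianPDFReal_nonneg 0 s x), hset]
  calc ∫ x in Set.Icc (-(t * Real.sqrt s)) (t * Real.sqrt s), gaussianPDFReal 0 s x
      ≤ ∫ _ in Set.Icc (-(t * Real.sqrt s)) (t * Real.sqrt s),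
          (Real.sqrt (2 * Real.pi * s))⁻¹ :=
        integral_mono (integrable_gaussianPDFReal 0 s).integrableOn
          (integrable_const _) hbound
    _ = 2 * t * (Real.sqrt (2 * Real.pi))⁻¹ := by
        have : 0 < Real.sqrt s := Real.sqrt_pos.2 hs0
        rw [setIntegral_const, Real.sqrt_mul (by positivity)]
        simp only [Measure.real, Real.volume_Icc, smul_eq_mul]
        rw [ENNReal.toReal_ofReal (by nlinarith [mul_nonneg ht this.le])]
        field_simp
        ring
    _ ≤ 2 * t * (4 / 3)⁻¹ := by gcongr
    _ = 3 / 2 * t := by ring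

section Direction

open MeasureTheory ProbabilityTheory
open scoped RealInnerProductSpace

variable {E : Type*} [NormedAddCommGroup E] [InnerProductSpace ℝ E] [FiniteDimensional ℝ E]
  [MeasurableSpace E] [BorelSpace E]

theorem stdGaussian_abs_inner_le {v : E} (hv : v ≠ 0) {t : ℝ} (ht : 0 ≤ t) :
    (stdGaussian E).real {a | |⟪v, a⟫| ≤ t * ‖v‖} ≤ 3 / 2 * t := by
  have hmap : (stdGaussian E).map (innerSL ℝ v) = gaussianReal 0 (‖v‖ ^ 2).toNNReal := by
    rw [IsGaussian.map_eq_gaussianReal, integral_strongDual_stdGaussian,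
      variance_dual_stdGaussian, innerSL_apply_norm]
  have hv' : (‖v‖ ^ 2).toNNReal ≠ 0 := by
    rw [Ne, Real.toNNReal_eq_zero, not_le]; positivity
  have h := gaussianReal_zero_abs_le hv' ht
  rw [← hmap, map_measureReal_apply (by fun_prop)
    (measurableSet_le (by fun_prop) (by fun_prop))] at h
  simpa [Real.coe_toNNReal _ (sq_nonneg ‖v‖)] using h

theorem integrable_norm_sq_stdGaussian : Integrable (fun a : E => ‖a‖ ^ 2) (stdGaussian E) :=
  (IsGaussian.memLp_two_id (μ := stdGaussian E)).integrable_norm_pow (by norm_num)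

theorem integral_norm_sq_stdGaussian :
    ∫ a : E, ‖a‖ ^ 2 ∂(stdGaussian E) = Module.finrank ℝ E := by
  set b := stdOrthonormalBasis ℝ E
  have h (i) : MemLp (fun a : E => ⟪b i, a⟫) 2 (stdGaussian E) :=
    IsGaussian.memLp_dual (stdGaussian E) (innerSL ℝ (b i)) 2 (by norm_num)
  have h1 (i) : ∫ a : E, ⟪b i, a⟫ ^ 2 ∂(stdGaussian E) = 1 := by
    have := variance_dual_stdGaussian (innerSL ℝ (b i))
    rw [variance_of_integral_eq_zero (by fun_prop) (integral_strongDual_stdGaussian _),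
      innerSL_apply_norm, b.norm_eq_one] at this
    simpa using this
  simp_rw [← b.sum_sq_inner_right]
  rw [integral_finsetSum _ fun i _ => (h i).integrable_sq]
  simp [h1]

open Classical in
/-- Among finitely many nonzero vectors, all but a fraction `q` have a component of relative size
more than `q / 2` along a suitable `a` of controlled norm. -/
theorem exists_direction {ι : Type*} (s : Finset ι) (v : ι → E) (hv : ∀ i ∈ s, v i ≠ 0) {q : ℝ}
    (hq : 0 < q) :
    ∃ a : E, ‖a‖ ^ 2 ≤ 4 * Module.finrank ℝ E ∧
      ((s.filter fun i => |⟪v i, a⟫| ≤ q / 2 * ‖v i‖).card : ℝ) ≤ q * s.card := by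
  rcases s.eq_empty_or_nonempty with rfl | hs
  · exact ⟨0, by simp, by simp⟩
  have hd : 0 < (Module.finrank ℝ E : ℝ) := by
    obtain ⟨i, hi⟩ := hs
    have := nontrivial_of_ne _ _ (hv i hi)
    exact_mod_cast Module.finrank_pos
  have hn : 0 < (s.card : ℝ) := by exact_mod_cast hs.card_pos
  set D : ℝ := (Module.finrank ℝ E : ℝ)
  let A : ι → Set E := fun i => {a | |⟪v i, a⟫| ≤ q / 2 * ‖v i‖}
  have hA (i) : MeasurableSet (A i) := measurableSet_le (by fun_prop) (by fun_prop)
  -- The weight of `‖a‖ ^ 2` is chosen such that this term has mean `q * s.card / 4`, and such that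
  -- `F a ≤ q * s.card` forces `‖a‖ ^ 2 ≤ 4 * D`.
  let F : E → ℝ := fun a =>
    (∑ i ∈ s, (A i).indicator (fun _ => (1 : ℝ)) a) + q * s.card / (4 * D) * ‖a‖ ^ 2
  have hI (i) : Integrable ((A i).indicator fun _ => (1 : ℝ)) (stdGaussian E) :=
    (integrable_const _).indicator (hA i)
  have hI' := (integrable_norm_sq_stdGaussian (E := E)).const_mul (q * s.card / (4 * D))
  have hF : Integrable F (stdGaussian E) := (integrable_finsetSum _ fun i _ => hI i).add hI'
  obtain ⟨a, ha⟩ := exists_le_integral hF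
  have hint : ∫ a, F a ∂(stdGaussian E) ≤ q * s.card := by
    rw [integral_add (integrable_finsetSum _ fun i _ => hI i) hI',
      integral_finsetSum _ fun i _ => hI i, integral_const_mul, integral_norm_sq_stdGaussian]
    have h1 : ∑ i ∈ s, ∫ a, (A i).indicator (fun _ => (1 : ℝ)) a ∂(stdGaussian E) ≤
        ∑ _i ∈ s, 3 / 4 * q := by
      refine Finset.sum_le_sum fun i hi => ?_
      rw [integral_indicator_const _ (hA i), smul_eq_mul, mul_one]
      exact (stdGaussian_abs_inner_le (hv i hi) (by positivity)).trans_eq (by ring)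
    have h2 : q * s.card / (4 * D) * D = q * s.card / 4 := by field_simp
    rw [Finset.sum_const, nsmul_eq_mul] at h1
    change _ + q * s.card / (4 * D) * D ≤ _
    rw [h2]
    linarith
  have hcount : ∑ i ∈ s, (A i).indicator (fun _ => (1 : ℝ)) a =
      ((s.filter fun i => |⟪v i, a⟫| ≤ q / 2 * ‖v i‖).card : ℝ) := by
    simp [A, Set.indicator_apply, Finset.sum_boole]
  have hle := ha.trans hint
  simp only [F, hcount] at hle
  refine ⟨a, ?_, ?_⟩
  · have : q * s.card / (4 * D) * ‖a‖ ^ 2 ≤ q * s.card := by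
      linarith [Nat.cast_nonneg (α := ℝ)
        (s.filter fun i => |⟪v i, a⟫| ≤ q / 2 * ‖v i‖).card]
    rw [div_mul_eq_mul_div, div_le_iff₀ (by positivity)] at this
    exact le_of_mul_le_mul_left this (by positivity)
  · have : 0 ≤ q * s.card / (4 * D) * ‖a‖ ^ 2 := by positivity
    linarith

/-- Iterating `exists_direction` on the vectors not yet handled: each step multiplies their number by
at most `q`, so that none is left after `m` steps. -/
theorem exists_directions {ι : Type*} (s : Finset ι) (v : ι → E) (hv : ∀ i ∈ s, v i ≠ 0) {q : ℝ}
    (hq : 0 < q) (m : ℕ) (hs : q ^ m * s.card < 1) :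
    ∃ a : Fin m → E, (∀ l, ‖a l‖ ^ 2 ≤ 4 * Module.finrank ℝ E) ∧
      ∀ i ∈ s, ∃ l, q / 2 * ‖v i‖ < |⟪v i, a l⟫| := by
  classical
  induction m generalizing s with
  | zero =>
    have : s.card = 0 := by
      rw [pow_zero, one_mul] at hs
      exact_mod_cast Nat.lt_one_iff.1 (by exact_mod_cast hs)
    refine ⟨Fin.elim0, fun l => l.elim0, ?_⟩
    simp [Finset.card_eq_zero.1 this]
  | succ m ih =>
    obtain ⟨a₀, h₀, hc⟩ := exists_direction s v hv hq
    obtain ⟨a, ha, hsep⟩ := ih (s.filter fun i => |⟪v i, a₀⟫| ≤ q / 2 * ‖v i‖)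
      (fun i hi => hv i (Finset.mem_filter.1 hi).1) (by
        calc q ^ m * _ ≤ q ^ m * (q * s.card) := by gcongr
          _ = q ^ (m + 1) * s.card := by ring
          _ < 1 := hs)
    refine ⟨Fin.cons a₀ a, fun l => Fin.cases h₀ ha l, fun i hi => ?_⟩
    by_cases hb : |⟪v i, a₀⟫| ≤ q / 2 * ‖v i‖
    · obtain ⟨l, hl⟩ := hsep i (Finset.mem_filter.2 ⟨hi, hb⟩)
      exact ⟨l.succ, hl⟩
    · exact ⟨0, not_le.1 hb⟩

end Direction

/-! ### Networks computing running maxima -/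

section Network

variable {d : ℕ} {S : Set (Fin d → ℝ)}

/-- The functions `φ i` on `S` are computed by the neurons of the `n`-th hidden layer of a network
all of whose hidden layers have width at most `k`: every network `g` with `k` inputs and width at
most `k` can be attached to them. Only the values on `S` matter. -/
def IsHiddenLayer (S : Set (Fin d → ℝ)) {k : ℕ} (n : ℕ) (φ : Fin k → S → ℝ) : Prop :=
  ∀ g : ReLUNetwork k, g.width ≤ k →
    ∃ f : ReLUNetwork d, f.width = k ∧ f.depth = n + g.depth ∧
      ∀ x : S, f.eval x = g.eval fun i => φ i x

/-- The functions on `S` of the form `∑ i, w i * φ i x + b`, that is, those which an affine layer can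
compute from the functions `φ i`. -/
def affineComb {ι : Type*} (φ : ι → S → ℝ) : Submodule ℝ (S → ℝ) :=
  Submodule.span ℝ (insert 1 (Set.range φ))

theorem mem_affineComb_iff {ι : Type*} [Fintype ι] {φ : ι → S → ℝ} {h : S → ℝ} :
    h ∈ affineComb φ ↔ ∃ (w : ι → ℝ) (b : ℝ), h = fun x => ∑ i, w i * φ i x + b := by
  rw [affineComb, Submodule.mem_span_insert]
  constructor
  · rintro ⟨b, z, hz, rfl⟩
    obtain ⟨w, rfl⟩ := (Submodule.mem_span_range_iff_exists_fun ℝ).1 hz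
    refine ⟨w, b, funext fun x => ?_⟩
    simp [Finset.sum_apply, add_comm]
  · rintro ⟨w, b, rfl⟩
    refine ⟨b, ∑ i, w i • φ i, (Submodule.mem_span_range_iff_exists_fun ℝ).2 ⟨w, rfl⟩,
      funext fun x => ?_⟩
    simp [Finset.sum_apply, add_comm]

theorem const_mem_affineComb {ι : Type*} (φ : ι → S → ℝ) (b : ℝ) :
    (fun _ => b) ∈ affineComb φ := by
  have : (fun _ : S => b) = b • 1 := by ext; simp
  rw [this]
  exact Submodule.smul_mem _ _ (Submodule.subset_span (Set.mem_insert _ _))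

theorem apply_mem_affineComb {ι : Type*} (φ : ι → S → ℝ) (i : ι) : φ i ∈ affineComb φ :=
  Submodule.subset_span (Set.mem_insert_of_mem _ ⟨i, rfl⟩)

theorem isHiddenLayer_one {k : ℕ} {φ : Fin k → S → ℝ} (w : Fin k → Fin d → ℝ) (b : Fin k → ℝ)
    (hφ : ∀ i x, φ i x = max 0 (w i ⬝ᵥ (x : Fin d → ℝ) + b i)) : IsHiddenLayer S 1 φ := by
  intro g hg
  refine ⟨.hidden k (Matrix.of w) b g, ?_, ?_, fun x => ?_⟩
  · simp [ReLUNetwork.width, hg]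
  · simp [ReLUNetwork.depth, add_comm]
  · simp only [ReLUNetwork.eval]
    congr 1
    ext i
    simp [hφ, Matrix.mulVec]

theorem IsHiddenLayer.succ {k n : ℕ} {φ ψ : Fin k → S → ℝ} (hφ : IsHiddenLayer S n φ)
    (h : ∀ i, ∃ h ∈ affineComb φ, ψ i = 0 ⊔ h) : IsHiddenLayer S (n + 1) ψ := by
  have h' : ∀ i, ∃ (w : Fin k → ℝ) (b : ℝ), ψ i = fun x => max 0 (∑ j, w j * φ j x + b) := by
    intro i
    obtain ⟨g, hg, hi⟩ := h i
    obtain ⟨w, b, rfl⟩ := mem_affineComb_iff.1 hg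
    exact ⟨w, b, hi⟩
  choose w b hwb using h'
  intro g hg
  obtain ⟨f, hf, hd, he⟩ := hφ (.hidden k (Matrix.of w) b g) (by simp [ReLUNetwork.width, hg])
  refine ⟨f, hf, by rw [hd, ReLUNetwork.depth]; ring, fun x => ?_⟩
  rw [he, ReLUNetwork.eval]
  congr 1
  ext i
  simp [hwb, Matrix.mulVec, dotProduct]

theorem IsHiddenLayer.exists_output {k n : ℕ} {φ : Fin k → S → ℝ} (hφ : IsHiddenLayer S n φ)
    {h : S → ℝ} (hh : h ∈ affineComb φ) :
    ∃ f : ReLUNetwork d, f.width = k ∧ f.depth = n + 1 ∧ ∀ x : S, f.eval x = h x := by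
  obtain ⟨w, b, rfl⟩ := mem_affineComb_iff.1 hh
  obtain ⟨f, hf, hd, he⟩ := hφ (.output (Matrix.of fun _ => w) fun _ => b)
    (by simp [ReLUNetwork.width])
  refine ⟨f, hf, hd, fun x => ?_⟩
  rw [he, ReLUNetwork.eval]
  simp [Matrix.mulVec, dotProduct]

/-- Some network of width `m + 6` carries, in its `n`-th hidden layer, the functions `z l` together with
`o` and `t`, the latter two as sums of two nonnegative neurons each. The two remaining neurons are
zero; they only bring the width to `m + 6`. -/
def HasAccumulators {m : ℕ} (n : ℕ) (z : Fin m → S → ℝ) (o t : S → ℝ) : Prop :=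
  ∃ o₁ o₂ t₁ t₂ : S → ℝ, 0 ≤ o₁ ∧ 0 ≤ o₂ ∧ 0 ≤ t₁ ∧ 0 ≤ t₂ ∧ o₁ + o₂ = o ∧ t₁ + t₂ = t ∧
    IsHiddenLayer S n (Fin.append z ![o₁, o₂, t₁, t₂, 0, 0])

namespace HasAccumulators

variable {m n : ℕ} {z : Fin m → S → ℝ} {o t : S → ℝ}

theorem nonneg_left (h : HasAccumulators n z o t) : 0 ≤ o := by
  obtain ⟨o₁, o₂, t₁, t₂, h₁, h₂, -, -, rfl, -⟩ := h
  exact add_nonneg h₁ h₂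

theorem nonneg_right (h : HasAccumulators n z o t) : 0 ≤ t := by
  obtain ⟨o₁, o₂, t₁, t₂, -, -, h₁, h₂, -, rfl, -⟩ := h
  exact add_nonneg h₁ h₂

/-- One layer replaces the two accumulated functions by maxima of affine combinations of what the
network carries: the neurons for `a ⊔ g` hold `a` and `0 ⊔ (g - a)`. -/
theorem succ (H : HasAccumulators n z o t) (hz : ∀ l, 0 ≤ z l) {a b g h : S → ℝ}
    (ha : 0 ≤ a) (hb : 0 ≤ b)
    (ha' : a ∈ affineComb (Fin.append z ![o, t])) (hb' : b ∈ affineComb (Fin.append z ![o, t]))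
    (hg : g ∈ affineComb (Fin.append z ![o, t])) (hh : h ∈ affineComb (Fin.append z ![o, t])) :
    HasAccumulators (n + 1) z (a ⊔ g) (b ⊔ h) := by
  obtain ⟨o₁, o₂, t₁, t₂, -, -, -, -, rfl, rfl, H⟩ := H
  have hacc (i : Fin 6) : (![o₁, o₂, t₁, t₂, 0, 0] : Fin 6 → S → ℝ) i ∈
      affineComb (Fin.append z ![o₁, o₂, t₁, t₂, 0, 0]) := by
    simpa using apply_mem_affineComb (Fin.append z ![o₁, o₂, t₁, t₂, 0, 0]) (Fin.natAdd m i)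
  have hzm (l : Fin m) : z l ∈ affineComb (Fin.append z ![o₁, o₂, t₁, t₂, 0, 0]) := by
    simpa using apply_mem_affineComb (Fin.append z ![o₁, o₂, t₁, t₂, 0, 0]) (Fin.castAdd 6 l)
  have hle : affineComb (Fin.append z ![o₁ + o₂, t₁ + t₂]) ≤
      affineComb (Fin.append z ![o₁, o₂, t₁, t₂, 0, 0]) := by
    refine Submodule.span_le.2 (Set.insert_subset
      (const_mem_affineComb _ 1) (Set.range_subset_iff.2 fun i => ?_))
    refine Fin.addCases (fun l => ?_) (fun j => ?_) i
    · simpa using hzm l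
    · fin_cases j
      · simpa using add_mem (hacc 0) (hacc 1)
      · simpa using add_mem (hacc 2) (hacc 3)
  -- The right argument of `+` is the neuron `0 ⊔ (v - u)`.
  have hmax (u v : S → ℝ) : u + 0 ⊔ (v - u) = u ⊔ v := by
    ext x
    simp [add_max]
  refine ⟨a, 0 ⊔ (g - a), b, 0 ⊔ (h - b), ha, le_sup_left, hb, le_sup_left, hmax _ _, hmax _ _,
    H.succ fun i => ?_⟩
  refine Fin.addCases (fun l => ?_) (fun j => ?_) i
  · exact ⟨z l, hzm l, by simp [hz l]⟩
  · fin_cases j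
    · exact ⟨a, hle ha', by simp [ha]⟩
    · exact ⟨g - a, hle (sub_mem hg ha'), by simp⟩
    · exact ⟨b, hle hb', by simp [hb]⟩
    · exact ⟨h - b, hle (sub_mem hh hb'), by simp⟩
    · exact ⟨0, zero_mem _, by simp⟩
    · exact ⟨0, zero_mem _, by simp⟩

theorem mem_left : o ∈ affineComb (Fin.append z ![o, t]) := by
  simpa using apply_mem_affineComb (Fin.append z ![o, t]) (Fin.natAdd m 0)

theorem mem_right : t ∈ affineComb (Fin.append z ![o, t]) := by
  simpa using apply_mem_affineComb (Fin.append z ![o, t]) (Fin.natAdd m 1)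

theorem mem_input (l : Fin m) : z l ∈ affineComb (Fin.append z ![o, t]) := by
  simpa using apply_mem_affineComb (Fin.append z ![o, t]) (Fin.castAdd 2 l)

/-- Two layers per coordinate take the maximum of `t` with `z l - c l` and with `c l - z l`. The result
is characterized by its upper bounds. -/
theorem exists_max_abs_sub (H : HasAccumulators n z o t) (hz : ∀ l, 0 ≤ z l) (c : Fin m → ℝ)
    (s : Finset (Fin m)) :
    ∃ t', HasAccumulators (n + 2 * s.card) z o t' ∧
      ∀ x M, t' x ≤ M ↔ t x ≤ M ∧ ∀ l ∈ s, |z l x - c l| ≤ M := by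
  induction s using Finset.induction_on with
  | empty => exact ⟨t, by simpa using H, by simp⟩
  | insert l s hl ih =>
    obtain ⟨t', H', ht'⟩ := ih
    have H₁ := H'.succ hz H'.nonneg_left H'.nonneg_right mem_left mem_right mem_left
      (sub_mem (mem_input l) (const_mem_affineComb _ (c l)))
    have H₂ := H₁.succ hz H₁.nonneg_left H₁.nonneg_right mem_left mem_right mem_left
      (sub_mem (const_mem_affineComb _ (c l)) (mem_input l))
    rw [sup_idem, sup_idem] at H₂
    refine ⟨_, by rwa [Finset.card_insert_of_notMem hl], fun x M => ?_⟩
    simp only [Pi.sup_apply, Pi.sub_apply, sup_le_iff, ht', Finset.forall_mem_insert,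
      abs_sub_le_iff]
    tauto

/-- The norm is the sup norm on `Fin m → ℝ`. -/
theorem max_norm_sub (H : HasAccumulators n z o t) (hz : ∀ l, 0 ≤ z l) (c : Fin m → ℝ) :
    HasAccumulators (n + 2 * m) z o fun x => max (t x) ‖(fun l => z l x) - c‖ := by
  obtain ⟨t', H', ht'⟩ := H.exists_max_abs_sub hz c Finset.univ
  have : t' = fun x => max (t x) ‖(fun l => z l x) - c‖ := by
    ext x
    refine eq_of_forall_ge_iff fun M => ?_
    rw [ht', max_le_iff]
    refine and_congr_right fun hM => ?_
    rw [pi_norm_le_iff_of_nonneg ((H.nonneg_right x).trans hM)]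
    simp
  simpa [this] using H'

/-- Running through the points `c i`, the inner accumulator is raised from `r` to
`max r ‖z - c i‖`, the outer one takes the maximum with the resulting bump of height `y i` and slope
`κ i`, and the inner one is reset to `r`. -/
theorem exists_max_bump {N : ℕ} {r : ℝ} (hr : 0 ≤ r) (H : HasAccumulators n z o fun _ => r)
    (hz : ∀ l, 0 ≤ z l)
    (c : Fin N → Fin m → ℝ) (y κ : Fin N → ℝ) (s : Finset (Fin N)) :
    ∃ o', HasAccumulators (n + (2 * m + 1) * s.card) z o' (fun _ => r) ∧
      ∀ x M, o' x ≤ M ↔ o x ≤ M ∧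
        ∀ i ∈ s, y i - κ i * (max r ‖(fun l => z l x) - c i‖ - r) ≤ M := by
  induction s using Finset.induction_on with
  | empty => exact ⟨o, by simpa using H, by simp⟩
  | insert i s hi ih =>
    obtain ⟨o', H', ho'⟩ := ih
    have H₁ := H'.max_norm_sub hz (c i)
    have H₂ := H₁.succ hz (b := fun _ => r) (h := fun _ => r) H₁.nonneg_left (fun _ => hr) mem_left
      (const_mem_affineComb _ r)
      (sub_mem (const_mem_affineComb _ (y i))
        (Submodule.smul_mem _ (κ i) (sub_mem mem_right (const_mem_affineComb _ r))))
      (const_mem_affineComb _ r)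
    rw [sup_idem] at H₂
    rw [show n + (2 * m + 1) * s.card + 2 * m + 1 = n + (2 * m + 1) * (insert i s).card by
      rw [Finset.card_insert_of_notMem hi]; ring] at H₂
    refine ⟨_, H₂, fun x M => ?_⟩
    simp only [Pi.sup_apply, Pi.sub_apply, Pi.smul_apply, smul_eq_mul, sup_le_iff, ho',
      Finset.forall_mem_insert]
    tauto

end HasAccumulators

/-- A network of width `m + 6` computes on `S` the maximum of `0` and the functions
`y i - κ i * (max r ‖w (x - p i)‖ - r)`, with the sup norm on `Fin m → ℝ`; the maximum is expressed
through its upper bounds. The lower bound `-B` on `S` allows a single neuron to carry each `w l ⬝ᵥ x`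
through the ReLU. -/
theorem exists_network_max_bump {N m : ℕ} (S : Set (Fin d → ℝ)) (w : Fin m → Fin d → ℝ)
    {B : ℝ} (hB : ∀ x ∈ S, ∀ l, -B ≤ w l ⬝ᵥ x) {r : ℝ} (hr : 0 ≤ r)
    (p : Fin N → Fin d → ℝ) (y κ : Fin N → ℝ) :
    ∃ f : ReLUNetwork d, f.width = m + 6 ∧ f.depth = N * (2 * m + 1) + 2 ∧
      ∀ x ∈ S, ∀ M, f.eval x ≤ M ↔ 0 ≤ M ∧
        ∀ i, y i - κ i * (max r ‖fun l => w l ⬝ᵥ (x - p i)‖ - r) ≤ M := by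
  let z : Fin m → S → ℝ := fun l x => w l ⬝ᵥ (x : Fin d → ℝ) + B
  have hz (l) : 0 ≤ z l := fun x => by
    have := hB x x.2 l
    simp only [Pi.zero_apply, z]
    linarith
  have H : HasAccumulators 1 z 0 fun _ => r := by
    refine ⟨0, 0, fun _ => r, 0, le_rfl, le_rfl, fun _ => hr, le_rfl, add_zero _, add_zero _,
      isHiddenLayer_one (Fin.append w 0) (Fin.append (fun _ => B) ![0, 0, r, 0, 0, 0]) ?_⟩
    intro i x
    refine Fin.addCases (fun l => ?_) (fun j => ?_) i
    · simpa [z] using hz l x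
    · fin_cases j <;> simp [hr]
  obtain ⟨o, H', ho⟩ := H.exists_max_bump hr hz (fun i l => w l ⬝ᵥ p i + B) y κ Finset.univ
  obtain ⟨o₁, o₂, t₁, t₂, -, -, -, -, hsum, -, H''⟩ := H'
  have hmem : o ∈ affineComb (Fin.append z ![o₁, o₂, t₁, t₂, 0, 0]) := by
    rw [← hsum]
    refine add_mem ?_ ?_
    · simpa using apply_mem_affineComb (Fin.append z ![o₁, o₂, t₁, t₂, 0, 0]) (Fin.natAdd m 0)
    · simpa using apply_mem_affineComb (Fin.append z ![o₁, o₂, t₁, t₂, 0, 0]) (Fin.natAdd m 1)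
  obtain ⟨f, hf, hd, he⟩ := H''.exists_output hmem
  refine ⟨f, hf, by rw [hd, Finset.card_univ, Fintype.card_fin]; ring, fun x hx M => ?_⟩
  have hsub (i) : ((fun l => z l ⟨x, hx⟩) - fun l => w l ⬝ᵥ p i + B) =
      fun l => w l ⬝ᵥ (x - p i) := by
    ext l
    simp [z, dotProduct_sub]
  have := ho ⟨x, hx⟩ M
  rw [he ⟨x, hx⟩, this]
  simp [hsub]

end Network

/-! ### Comparison of norms -/

theorem lpNorm_two_eq {d : ℕ} (v : Fin d → ℝ) : lpNorm 2 v = ‖WithLp.toLp 2 v‖ := rfl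

theorem lpNorm_two_sq {d : ℕ} (v : Fin d → ℝ) : lpNorm 2 v ^ 2 = ∑ i, v i ^ 2 := by
  simp [lpNorm, EuclideanSpace.real_norm_sq_eq]

theorem lpNorm_nonneg {d : ℕ} (p : ENNReal) (hp : 0 < p) (v : Fin d → ℝ) : 0 ≤ lpNorm p v := by
  rcases eq_or_ne p ⊤ with rfl | hp'
  · rw [lpNorm_top]
    exact Real.iSup_nonneg fun i => abs_nonneg _
  · rw [lpNorm_of_ne_top p hp hp']
    positivity

theorem lpNorm_two_le_of_le_two {d : ℕ} {p : ENNReal} (hp : 0 < p) (hp2 : p ≤ 2)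
    (v : Fin d → ℝ) : lpNorm 2 v ≤ lpNorm p v := by
  have hp' : p ≠ ⊤ := ne_top_of_le_ne_top (by norm_num) hp2
  have hr : 0 < p.toReal := ENNReal.toReal_pos hp.ne' hp'
  have hr2 : p.toReal ≤ 2 := by simpa using ENNReal.toReal_mono (by norm_num) hp2
  have hM := lpNorm_nonneg p hp v
  have hS : lpNorm p v ^ p.toReal = ∑ i, |v i| ^ p.toReal := by
    rw [lpNorm_of_ne_top p hp hp', ← Real.rpow_mul (by positivity), one_div,
      inv_mul_cancel₀ hr.ne', Real.rpow_one]
  have hle (i) : |v i| ≤ lpNorm p v := by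
    refine (Real.rpow_le_rpow_iff (abs_nonneg _) hM hr).1 ?_
    rw [hS]
    exact Finset.single_le_sum (f := fun i => |v i| ^ p.toReal)
      (fun j _ => by positivity) (Finset.mem_univ i)
  refine (pow_le_pow_iff_left₀ (lpNorm_nonneg 2 (by norm_num) v) hM two_ne_zero).1 ?_
  -- `|vᵢ| ^ 2 ≤ |vᵢ| ^ p * M ^ (2 - p)` with `M` the `ℓ_p` norm, and `∑ |vᵢ| ^ p = M ^ p`.
  have hsplit {x : ℝ} (hx : 0 ≤ x) : x ^ 2 = x ^ p.toReal * x ^ (2 - p.toReal) := by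
    rw [← Real.rpow_add_of_nonneg hx hr.le (by linarith)]
    norm_num
  calc lpNorm 2 v ^ 2 = ∑ i, |v i| ^ p.toReal * |v i| ^ (2 - p.toReal) := by
        rw [lpNorm_two_sq]
        exact Finset.sum_congr rfl fun i _ => by rw [← hsplit (abs_nonneg _), sq_abs]
    _ ≤ ∑ i, |v i| ^ p.toReal * lpNorm p v ^ (2 - p.toReal) := by
        gcongr with i
        exact hle i
    _ = lpNorm p v ^ 2 := by rw [← Finset.sum_mul, ← hS, ← hsplit hM]

theorem lpNorm_two_le_of_two_le {d : ℕ} (hd : 0 < d) {p : ENNReal} (hp : 2 ≤ p)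
    (v : Fin d → ℝ) :
    lpNorm 2 v ≤ (d : ℝ) ^ (1 / 2 - (p⁻¹).toReal) * lpNorm p v := by
  have hp0 : 0 < p := lt_of_lt_of_le (by norm_num) hp
  have hd0 : (0 : ℝ) < d := by exact_mod_cast hd
  have hM := lpNorm_nonneg p hp0 v
  refine (pow_le_pow_iff_left₀ (lpNorm_nonneg 2 (by norm_num) v) (by positivity)
    two_ne_zero).1 ?_
  rw [lpNorm_two_sq, mul_pow, ← Real.rpow_natCast (_ ^ _) 2, ← Real.rpow_mul hd0.le]
  rcases eq_or_ne p ⊤ with rfl | hp'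
  · have hle (i) : |v i| ≤ lpNorm ⊤ v := by
      rw [lpNorm_top]
      exact le_ciSup (f := fun i => |v i|) (Set.finite_range _).bddAbove i
    calc ∑ i, v i ^ 2 ≤ ∑ _i : Fin d, lpNorm ⊤ v ^ 2 := by
          refine Finset.sum_le_sum fun i _ => ?_
          rw [← sq_abs]
          gcongr
          exact hle i
      _ = _ := by simp
  · have hr2 : 2 ≤ p.toReal := by simpa using ENNReal.toReal_mono hp' hp
    -- The power mean inequality for the numbers `vᵢ ^ 2` and the exponent `p / 2`.
    have h := Real.rpow_sum_le_const_mul_sum_rpow_of_nonneg (Finset.univ : Finset (Fin d))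
      (f := fun i => v i ^ 2) (p := p.toReal / 2) (by linarith) fun i _ => sq_nonneg _
    have hpow (i) : (v i ^ 2) ^ (p.toReal / 2) = |v i| ^ p.toReal := by
      rw [← sq_abs, ← Real.rpow_natCast, ← Real.rpow_mul (abs_nonneg _)]
      congr 1
      push_cast
      ring
    simp only [hpow, Finset.card_univ, Fintype.card_fin] at h
    refine (Real.rpow_le_rpow_iff (by positivity) (by positivity)
      (by linarith : 0 < p.toReal / 2)).1 (h.trans_eq ?_)
    rw [Real.mul_rpow (by positivity) (by positivity), ← Real.rpow_mul hd0.le,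
      ← Real.rpow_natCast (lpNorm p v) 2, ← Real.rpow_mul hM, lpNorm_of_ne_top p hp0 hp',
      ← Real.rpow_mul (by positivity), ENNReal.toReal_inv]
    have hr : p.toReal ≠ 0 := by linarith
    congr 1
    · congr 1
      push_cast
      field_simp
    · rw [show 1 / p.toReal * ((2 : ℕ) * (p.toReal / 2)) = 1 by push_cast; field_simp,
        Real.rpow_one]

theorem lpNorm_two_le {d : ℕ} (hd : 0 < d) {p : ENNReal} (hp : 0 < p) (v : Fin d → ℝ) :
    lpNorm 2 v ≤ (d : ℝ) ^ (-min 0 ((p⁻¹).toReal - 1 / 2)) * lpNorm p v := by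
  rcases le_total p 2 with h | h
  · have : (1 / 2 : ℝ) ≤ (p⁻¹).toReal := by
      simpa using ENNReal.toReal_mono (ENNReal.inv_ne_top.2 hp.ne') (ENNReal.inv_le_inv.2 h)
    rw [min_eq_left (by linarith)]
    simpa using lpNorm_two_le_of_le_two hp h v
  · have : (p⁻¹).toReal ≤ (1 / 2 : ℝ) := by
      simpa using ENNReal.toReal_mono (by simp) (ENNReal.inv_le_inv.2 h)
    rw [min_eq_right (by linarith), neg_sub]
    exact lpNorm_two_le_of_two_le hd h v

theorem abs_dotProduct_le {d : ℕ} (a v : Fin d → ℝ) : |a ⬝ᵥ v| ≤ lpNorm 2 a * lpNorm 2 v := by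
  have := abs_real_inner_le_norm (WithLp.toLp 2 v : EuclideanSpace ℝ (Fin d)) (WithLp.toLp 2 a)
  rw [mul_comm]
  simpa [EuclideanSpace.inner_toLp_toLp, lpNorm_two_eq] using this

/-! ### Robust memorization -/

/-- A linear map to `ℝᵐ` with rows of norm at most `2 √d` that keeps differently labeled points at sup
distance more than `N ^ (-2 / m) δ / 2`. The exponent is the one for which `m` applications of
`exists_direction` exhaust the at most `N ^ 2` pairs. -/
theorem LabeledDataset.IsSeparated.exists_projection {d N C : ℕ} (hN : 0 < N)
    {D : LabeledDataset d N C} {δ : ℝ} (hδ : 0 < δ) (hD : D.IsSeparated δ) {m : ℕ} (hm : 0 < m) :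
    ∃ w : Fin m → Fin d → ℝ, (∀ l, lpNorm 2 (w l) ≤ 2 * Real.sqrt d) ∧
      ∀ i j, D.label i ≠ D.label j →
        (N : ℝ) ^ (-(2 / (m : ℝ))) / 2 * δ < ‖fun l => w l ⬝ᵥ (D.point i - D.point j)‖ := by
  classical
  have hN0 : (0 : ℝ) < N := by exact_mod_cast hN
  set q : ℝ := (N : ℝ) ^ (-(2 / (m : ℝ)))
  have hq : 0 < q := by positivity
  have hqm : q ^ m = ((N : ℝ) ^ 2)⁻¹ := by
    have hm0 : (m : ℝ) ≠ 0 := by positivity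
    rw [← Real.rpow_natCast, ← Real.rpow_mul hN0.le, ← Real.rpow_natCast, ← Real.rpow_neg hN0.le]
    congr 1
    push_cast
    field_simp
  let s : Finset (Fin N × Fin N) := Finset.univ.filter fun e => D.label e.1 ≠ D.label e.2
  let v : Fin N × Fin N → EuclideanSpace ℝ (Fin d) :=
    fun e => WithLp.toLp 2 (D.point e.1 - D.point e.2)
  have hsep : ∀ e ∈ s, δ ≤ ‖v e‖ := fun e he =>
    hD.2 ⟨e.1, e.2, (Finset.mem_filter.1 he).2, rfl⟩
  -- The diagonal pairs are not in `s`, which makes the count strictly less than `N ^ 2`.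
  have hcard : s.card < N ^ 2 := by
    have : s.card < (Finset.univ : Finset (Fin N × Fin N)).card :=
      Finset.card_lt_card (Finset.filter_ssubset.2 ⟨(⟨0, hN⟩, ⟨0, hN⟩), by simp⟩)
    simpa [sq] using this
  obtain ⟨a, ha, hsa⟩ := exists_directions s v
    (fun e he => norm_pos_iff.1 (hδ.trans_le (hsep e he))) hq m (by
      rw [hqm, inv_mul_lt_iff₀ (by positivity), mul_one]
      exact_mod_cast hcard)
  refine ⟨fun l => (a l).ofLp, fun l => ?_, fun i j hij => ?_⟩
  · have := ha l
    rw [finrank_euclideanSpace_fin] at this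
    refine abs_le_of_sq_le_sq' (b := 2 * Real.sqrt d) ?_ (by positivity) |>.2
    rw [mul_pow, Real.sq_sqrt (by positivity), lpNorm_two_eq, WithLp.toLp_ofLp]
    linarith
  · have hmem : (i, j) ∈ s := by simpa [s] using hij
    obtain ⟨l, hl⟩ := hsa _ hmem
    calc q / 2 * δ ≤ q / 2 * ‖v (i, j)‖ := by gcongr; exact hsep _ hmem
      _ < |inner ℝ (v (i, j)) (a l)| := hl
      _ = ‖(a l).ofLp ⬝ᵥ (D.point i - D.point j)‖ := by
        rw [Real.norm_eq_abs]
        simp [v, EuclideanSpace.inner_eq_star_dotProduct]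
      _ ≤ _ := norm_le_pi_norm (fun l => (a l).ofLp ⬝ᵥ (D.point i - D.point j)) l

/-- If a linear map sends the `ℓ_p` ball of radius `σ` into the sup norm ball of radius `r` and keeps
differently labeled points at distance `R + r` with `r < R`, then the bumps that equal the label up
to distance `r` from a point and vanish at distance `R` do not interfere. -/
theorem exists_network_robustlyMemorizes {d N C m : ℕ} (D : LabeledDataset d N C) {σ r R : ℝ}
    {p : ENNReal} (w : Fin m → Fin d → ℝ) (hr : 0 ≤ r) (hR : r < R)
    (hball : ∀ x, lpNorm p x ≤ σ → ‖fun l => w l ⬝ᵥ x‖ ≤ r)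
    (hsep : ∀ i j, D.label i ≠ D.label j →
      R + r ≤ ‖fun l => w l ⬝ᵥ (D.point i - D.point j)‖) :
    ∃ f : ReLUNetwork d, f.width = m + 6 ∧ f.depth = N * (2 * m + 1) + 2 ∧
      RobustlyMemorizes σ p f.eval D := by
  -- The shift `B` only has to work on the union of the balls, which is bounded after projection.
  let S : Set (Fin d → ℝ) := {x | ∃ i, lpNorm p (x - D.point i) ≤ σ}
  have hsplit (x : Fin d → ℝ) (i : Fin N) : (fun l => w l ⬝ᵥ x) =
      (fun l => w l ⬝ᵥ (x - D.point i)) + fun l => w l ⬝ᵥ D.point i := by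
    ext l
    simp [dotProduct_sub]
  have hB : ∀ x ∈ S, ∀ l, -(r + ∑ i, ‖fun l => w l ⬝ᵥ D.point i‖) ≤ w l ⬝ᵥ x := by
    rintro x ⟨i, hi⟩ l
    have h₁ : |w l ⬝ᵥ x| ≤ ‖fun l => w l ⬝ᵥ x‖ := norm_le_pi_norm (fun l => w l ⬝ᵥ x) l
    have h₂ : ‖fun l => w l ⬝ᵥ x‖ ≤ r + ‖fun l => w l ⬝ᵥ D.point i‖ := by
      rw [hsplit x i]
      exact (norm_add_le _ _).trans (by gcongr; exact hball _ hi)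
    have h₃ : ‖fun l => w l ⬝ᵥ D.point i‖ ≤ ∑ i, ‖fun l => w l ⬝ᵥ D.point i‖ :=
      Finset.single_le_sum (f := fun i => ‖fun l => w l ⬝ᵥ D.point i‖)
        (fun _ _ => norm_nonneg _) (Finset.mem_univ i)
    linarith [neg_abs_le (w l ⬝ᵥ x)]
  have hRr : 0 < R - r := sub_pos.2 hR
  obtain ⟨f, hf, hd, he⟩ := exists_network_max_bump S w hB hr D.point
    (fun i => (D.label i : ℝ)) fun i => (D.label i : ℝ) / (R - r)
  refine ⟨f, hf, hd, fun i x hx => le_antisymm ?_ ?_⟩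
  · refine (he x ⟨i, hx⟩ _).2 ⟨Nat.cast_nonneg _, fun j => ?_⟩
    by_cases hij : D.label i = D.label j
    · rw [hij]
      have : 0 ≤ max r ‖fun l => w l ⬝ᵥ (x - D.point j)‖ - r := sub_nonneg.2 (le_max_left _ _)
      have : 0 ≤ (D.label j : ℝ) / (R - r) * (max r ‖fun l => w l ⬝ᵥ (x - D.point j)‖ - r) := by
        positivity
      linarith
    · have hfar : R ≤ ‖fun l => w l ⬝ᵥ (x - D.point j)‖ := by
        have h₁ := hsep i j hij
        have h₂ : (fun l => w l ⬝ᵥ (D.point i - D.point j)) =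
            (fun l => w l ⬝ᵥ (x - D.point j)) - fun l => w l ⬝ᵥ (x - D.point i) := by
          ext l
          simp [dotProduct_sub]
        rw [h₂] at h₁
        linarith [norm_sub_le (fun l => w l ⬝ᵥ (x - D.point j))
          (fun l => w l ⬝ᵥ (x - D.point i)), hball _ hx]
      have : (D.label j : ℝ) / (R - r) * (R - r) ≤
          (D.label j : ℝ) / (R - r) * (max r ‖fun l => w l ⬝ᵥ (x - D.point j)‖ - r) := by
        gcongr
        exact le_max_of_le_right hfar
      rw [div_mul_cancel₀ _ hRr.ne'] at this
      linarith [Nat.cast_nonneg (α := ℝ) (D.label i)]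
  · have := ((he x ⟨i, hx⟩ _).1 le_rfl).2 i
    rwa [max_eq_left (hball _ hx), sub_self, mul_zero, sub_zero] at this

theorem mainTheorem1 :
    ∃ c : ℝ, 0 < c ∧
      ∀ (N d C k : ℕ) (p : ENNReal) (δ σ : ℝ),
        2 ≤ N → 2 ≤ d → 2 ≤ C → 7 ≤ k → k ≤ d + 5 → 0 < p → 0 < δ → 0 ≤ σ →
        σ / δ ≤ radiusConstant p d * (N : ℝ) ^ (-(2 / ((k : ℝ) - 6))) →
        ∀ D : LabeledDataset d N C, D.IsSeparated δ →
          ∃ f : ReLUNetwork d,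
            f.width = k ∧
            (f.depth : ℝ) ≤ c * (N : ℝ) * (k : ℝ) * Real.logb 2 (k : ℝ) ∧
            RobustlyMemorizes σ p f.eval D := by
  refine ⟨2, two_pos, ?_⟩
  intro N d C k p δ σ hN hd _ hk _ hp hδ hσ hratio D hD
  obtain ⟨m, rfl⟩ : ∃ m, k = m + 6 := ⟨k - 6, by omega⟩
  have hd0 : (0 : ℝ) < d := by exact_mod_cast (by omega : 0 < d)
  have hN0 : (2 : ℝ) ≤ N := by exact_mod_cast hN
  obtain ⟨w, hw, hsep⟩ := hD.exists_projection (by omega) hδ (m := m) (by omega)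
  rw [show ((m + 6 : ℕ) : ℝ) - 6 = m by push_cast; ring] at hratio
  set q : ℝ := (N : ℝ) ^ (-(2 / (m : ℝ)))
  set e : ℝ := min 0 ((p⁻¹).toReal - 1 / 2)
  set r : ℝ := 2 * Real.sqrt d * ((d : ℝ) ^ (-e) * σ)
  have hr2 : 2 * r < q / 2 * δ := by
    rw [div_le_iff₀ hδ, radiusConstant] at hratio
    have he1 : 1 < Real.sqrt (Real.exp 1) :=
      Real.lt_sqrt_of_sq_lt (by simp)
    -- The dimension factor in `radiusConstant` cancels the norm of the rows of `w` and the cost of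
    -- passing from `ℓ_p` to the Euclidean norm.
    have hpow : Real.sqrt d * (d : ℝ) ^ (-e) * (d : ℝ) ^ (-(1 / 2 : ℝ) + e) = 1 := by
      rw [Real.sqrt_eq_rpow, ← Real.rpow_add hd0, ← Real.rpow_add hd0,
        show 1 / 2 + -e + (-(1 / 2 : ℝ) + e) = 0 by ring, Real.rpow_zero]
    calc 2 * r = 4 * (Real.sqrt d * (d : ℝ) ^ (-e)) * σ := by ring
      _ ≤ 4 * (Real.sqrt d * (d : ℝ) ^ (-e)) * (1 / (8 * Real.sqrt (Real.exp 1)) *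
          (d : ℝ) ^ (-(1 / 2 : ℝ) + e) * q * δ) := by gcongr
      _ = 4 * (1 / (8 * Real.sqrt (Real.exp 1))) * (Real.sqrt d * (d : ℝ) ^ (-e) *
          (d : ℝ) ^ (-(1 / 2 : ℝ) + e)) * q * δ := by ring
      _ < 4 * (1 / (8 * 1)) * 1 * q * δ := by rw [hpow]; gcongr
      _ = q / 2 * δ := by ring
  have hball : ∀ x, lpNorm p x ≤ σ → ‖fun l => w l ⬝ᵥ x‖ ≤ r := by
    intro x hx
    refine (pi_norm_le_iff_of_nonneg (by positivity)).2 fun l => ?_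
    calc |w l ⬝ᵥ x| ≤ lpNorm 2 (w l) * lpNorm 2 x := abs_dotProduct_le _ _
      _ ≤ 2 * Real.sqrt d * ((d : ℝ) ^ (-e) * σ) := by
        refine mul_le_mul (hw l) ?_ (lpNorm_nonneg 2 (by norm_num) _) (by positivity)
        exact (lpNorm_two_le (by omega) hp x).trans (by gcongr)
  obtain ⟨f, hf, hdep, hmem⟩ := exists_network_robustlyMemorizes D w (r := r) (R := q / 2 * δ - r)
    (by positivity) (by linarith) hball fun i j hij => by linarith [hsep i j hij]
  refine ⟨f, hf, ?_, hmem⟩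
  have hlog : 1 ≤ Real.logb 2 ((m + 6 : ℕ) : ℝ) := by
    rw [Real.le_logb_iff_rpow_le one_lt_two (by positivity)]
    push_cast
    norm_num
    linarith [Nat.cast_nonneg (α := ℝ) m]
  calc (f.depth : ℝ) = N * (2 * m + 1) + 2 := by rw [hdep]; push_cast; ring
    _ ≤ 2 * N * ((m + 6 : ℕ) : ℝ) * 1 := by push_cast; linarith
    _ ≤ 2 * N * ((m + 6 : ℕ) : ℝ) * Real.logb 2 ((m + 6 : ℕ) : ℝ) := by gcongr
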